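/- Let $n\ge 1$, let $\mathbb B_n=\{z\in\mathbb C^n:\|z\|<1\}$ and $\mathbb S_n=\{z\in\mathbb C^n:\|z\|=1\}$ for the Euclidean norm, and $\langle z,w\rangle=\sum_i z_i\overline{w_i}$. For $\alpha\in\mathbb R$ let $D_\alpha(\mathbb B_n)$ be the space of holomorphic functions $f(z)=\sum_{k\in\mathbb N^n}a_kz^k$ on $\mathbb B_n$ with $$\|f\|_\alpha^2=\sum_{k}(n+|k|)^\alpha\,\frac{(n-1)!\,k!}{(n-1+|k|)!}\,|a_k|^2<\infty ,$$ where $|k|=k_1+\dots+k_n$ and $k!=k_1!\cdots k_n!$. A function $f\in D_\alpha(\mathbb B_n)$ is called cyclic if the closure in $D_\alpha(\mathbb B_n)$, with respect to $\|\cdot\|_\alpha$, of $\mathrm{span}\{z^kf:k\in\mathbb N^n\}$ is all of $D_\alpha(\mathbb B_n)$. Let $\mathcal Z(f^*)$ be the set of those $\zeta\in\mathbb S_n$ for which the radial limit $f^*(\zeta)=\lim_{r\to1^-}f(r\zeta)$ exists and equals $0$. For $\alpha\in(0,n]$ let $K_\alpha(t)=t^{\alpha-n}$ if $\alpha<n$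 and $K_n(t)=\log(e/t)$ for $t>0$, with $K_\alpha(0)=\infty$, and for a Borel set $E\subset\mathbb S_n$ put $$\mathrm{cap}_\alpha(E)=\Big(\inf_\mu\iint K_\alpha(|1-\langle\zeta,\eta\rangle|)\,d\mu(\zeta)\,d\mu(\eta)\Big)^{-1},$$ where $\mu$ runs over all Borel probability measures supported on $E$ (that is, with no mass outside $E$), and $\mathrm{cap}_\alpha(E)=0$ if the infimum is $\infty$ or if there is no such $\mu$. Theorem. Let $\alpha\in(0,n]$ and $f\in D_\alpha(\mathbb B_n)$. If $\mathrm{cap}_\alpha(\mathcal Z(f^*))>0$, then $f$ is not cyclic in $D_\alpha(\mathbb B_n)$. -/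

import Mathlib

open Set Filter Topology MeasureTheory
open scoped ENNReal Nat

noncomputable section

namespace DirichletBall

/-- `ℂⁿ` with its Euclidean norm. -/
abbrev Cn (n : ℕ) : Type := EuclideanSpace ℂ (Fin n)

variable {n : ℕ}

/-- The open unit ball of `ℂⁿ`. -/
def unitBall (n : ℕ) : Set (Cn n) := {z | ‖z‖ < 1}

/-- The unit sphere of `ℂⁿ`. -/
def unitSphere (n : ℕ) : Set (Cn n) := {z | ‖z‖ = 1}

/-- Holomorphic functions in the unit ball: near each point of the ball the function is the sum of
a convergent (complex, `n`-variable) power series. Values outside the ball are irrelevant. -/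
def IsHol (f : Cn n → ℂ) : Prop := AnalyticOnNhd ℂ f (unitBall n)

/-- The length `|k| = k₁ + ⋯ + kₙ` of a multi-index. -/
def len (k : Fin n → ℕ) : ℕ := ∑ i, k i

/-- `k! = k₁! ⋯ kₙ!`. -/
def multiFactorial (k : Fin n → ℕ) : ℕ := ∏ i, (k i)!

/-- The monomial `z^k = z₁^{k₁} ⋯ zₙ^{kₙ}`. -/
def monom (k : Fin n → ℕ) (z : Cn n) : ℂ := ∏ i, z i ^ k i

/-- The complex partial derivative `∂g/∂zᵢ`. -/
def partialDeriv (i : Fin n) (g : Cn n → ℂ) (z : Cn n) : ℂ :=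
  fderiv ℂ g z (EuclideanSpace.single i 1)

/-- The iterated partial derivative `∂₁^{k₁} ⋯ ∂ₙ^{kₙ} f`. -/
def iteratedPartialDeriv (k : Fin n → ℕ) (f : Cn n → ℂ) : Cn n → ℂ :=
  (List.finRange n).foldr (fun i g => (partialDeriv i)^[k i] g) f

/-- The coefficient `a_k = ∂^k f(0) / k!` of the power series expansion `f(z) = ∑ a_k z^k`. -/
def taylorCoeff (f : Cn n → ℂ) (k : Fin n → ℕ) : ℂ :=
  iteratedPartialDeriv k f 0 / (multiFactorial k : ℂ)

/-- The weight `(n + |k|)^α (n-1)! k! / (n-1+|k|)!` (used for `n ≥ 1`). -/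
def weight (α : ℝ) (k : Fin n → ℕ) : ℝ :=
  ((n : ℝ) + len k) ^ α * (((n - 1)! : ℝ) * multiFactorial k / ((n - 1 + len k)! : ℝ))

/-- The norm `‖f‖_α`, `‖f‖_α² = ∑_k (n + |k|)^α (n-1)! k! / (n-1+|k|)! |a_k|²`, as an element of
`[0, ∞]`. -/
def dirichletNorm (α : ℝ) (f : Cn n → ℂ) : ℝ≥0∞ :=
  (∑' k : Fin n → ℕ, ENNReal.ofReal (weight α k * ‖taylorCoeff f k‖ ^ 2)) ^ (1 / 2 : ℝ)

/-- The Dirichlet-type space `D_α` of the ball, as a set of functions. -/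
def dirichletSpace (n : ℕ) (α : ℝ) : Set (Cn n → ℂ) :=
  {f | IsHol f ∧ dirichletNorm α f < ∞}

/-- `[f]`: the closure in `D_α`, with respect to its norm, of the linear span of the functions
`z^k f`. -/
def closedInvariantSubspace (α : ℝ) (f : Cn n → ℂ) : Set (Cn n → ℂ) :=
  {g | g ∈ dirichletSpace n α ∧ ∀ ε : ℝ≥0∞, 0 < ε →
    ∃ h ∈ Submodule.span ℂ (range fun (k : Fin n → ℕ) (z : Cn n) => monom k z * f z),
      dirichletNorm α (g - h) < ε}

/-- `f` is a cyclic vector of `D_α`. -/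
def IsCyclic (α : ℝ) (f : Cn n → ℂ) : Prop :=
  f ∈ dirichletSpace n α ∧ closedInvariantSubspace α f = dirichletSpace n α

/-- The zero set `𝒵(f*)` of the radial limits `f*(ζ) = lim_{r → 1⁻} f(rζ)`: the points `ζ` of the
sphere at which this limit exists and is zero. -/
def radialZeroSet (f : Cn n → ℂ) : Set (Cn n) :=
  {ζ | ζ ∈ unitSphere n ∧ Tendsto (fun r : ℝ => f ((r : ℂ) • ζ)) (𝓝[<] 1) (𝓝 0)}

open Classical in
/-- The kernel `K_α(t) = t^{α-n}` for `α < n`, `K_n(t) = log(e/t)`, with `K_α(0) = ∞`.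
It is only evaluated at `t = |1 - ⟨ζ,η⟩| ∈ [0,2]`, where it is nonnegative. -/
def rieszKernel (n : ℕ) (α t : ℝ) : ℝ≥0∞ :=
  if t = 0 then ∞
  else if α = n then ENNReal.ofReal (Real.log (Real.exp 1 / t))
  else ENNReal.ofReal (t ^ (α - n))

/-- The Riesz `α`-energy of `μ`. In Mathlib `inner ℂ η ζ = ∑ ζᵢ conj(ηᵢ)`, that is `⟨ζ,η⟩`. -/
def rieszEnergy (α : ℝ) (μ : Measure (Cn n)) : ℝ≥0∞ :=
  ∫⁻ η, ∫⁻ ζ, rieszKernel n α ‖1 - inner ℂ η ζ‖ ∂μ ∂μ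

/-- The Riesz `α`-capacity `(inf I_α[μ])⁻¹`, the infimum being over all Borel probability measures
carried by `E`; it is `0` if there are none of finite energy. -/
def rieszCapacity (α : ℝ) (E : Set (Cn n)) : ℝ≥0∞ :=
  (⨅ (μ : Measure (Cn n)) (_ : IsProbabilityMeasure μ ∧ μ Eᶜ = 0), rieszEnergy α μ)⁻¹

end DirichletBall

end

noncomputable section

namespace DirichletBall

variable {n : ℕ}

/-! ### Homogeneous expansion of holomorphic functions on the ball -/

/-! Positive capacity gives a probability measure `μ` of finite energy carried by the zero set of
the radial limits. The idea is to use `g ↦ ∫ g(rζ) dμ(ζ)` as functionals that almost annihilate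
every `z^k f` but not `1`.

Finite energy bounds these functionals on `D_α` uniformly in `r < 1`
(`norm_integral_dilation_sq_le`). By Cauchy–Schwarz the squared norm is at most `∑ r^{2|k|} |∫ ζ^k
dμ|² / weight`. Since `1 / weight` is a function of `|k|` times a multinomial coefficient
(`inv_weight`), this sum equals `∬ k(r²⟨ζ,η⟩) dμ dμ`, where `k(x) = ∑ kernelCoeff n α m * x^m`. The
bound `|k(ρw)| ≤ C K_α(|1-w|)` of `exists_kernel_bound`, uniform in `ρ`, then dominates it by the
energy.

By Egorov (`exists_uniform_radial_limit`), `f(r_j ζ) → 0` uniformly on a set `F` with `μ F > 0`, and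
`μ.restrict F` still has finite energy. Every `h` in the span of the `z^k f` inherits this uniform
decay, so `∫_F (1 - h)(r_j ζ) dμ → μ F`. The uniform bound therefore keeps `‖1 - h‖_α` away from
`0`, and `1` is not in the closure. No boundary values of general elements of `D_α` are needed, only
dilations. -/

lemma isOpen_unitBall : IsOpen (unitBall n) := isOpen_lt continuous_norm continuous_const

lemma isHol_congr {f g : Cn n → ℂ} (hf : IsHol f) (h : EqOn f g (unitBall n)) : IsHol g :=
  AnalyticOnNhd.congr isOpen_unitBall hf h

lemma partialDeriv_congr {f g : Cn n → ℂ} (h : EqOn f g (unitBall n)) (i : Fin n) :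
    EqOn (partialDeriv i f) (partialDeriv i g) (unitBall n) := fun z hz => by
  have : f =ᶠ[𝓝 z] g := Filter.eventuallyEq_of_mem (isOpen_unitBall.mem_nhds hz) h
  simp only [partialDeriv, this.fderiv_eq]

lemma IsHol.partialDeriv {f : Cn n → ℂ} (hf : IsHol f) (i : Fin n) : IsHol (partialDeriv i f) :=
  (ContinuousLinearMap.analyticOnNhd
    (ContinuousLinearMap.apply ℂ ℂ (EuclideanSpace.single i (1 : ℂ) : Cn n)) univ).comp
    (AnalyticOnNhd.fderiv hf) (fun _ _ => mem_univ _)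

lemma IsHol.differentiableAt {f : Cn n → ℂ} (hf : IsHol f) {z : Cn n} (hz : z ∈ unitBall n) :
    DifferentiableAt ℂ f z := (hf z hz).differentiableAt

lemma IsHol.partialDeriv_comm {f : Cn n → ℂ} (hf : IsHol f) (i j : Fin n) {z : Cn n}
    (hz : z ∈ unitBall n) :
    DirichletBall.partialDeriv i (DirichletBall.partialDeriv j f) z =
      DirichletBall.partialDeriv j (DirichletBall.partialDeriv i f) z := by
  have hd : DifferentiableAt ℂ (fderiv ℂ f) z := ((AnalyticOnNhd.fderiv hf) z hz).differentiableAt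
  have key : ∀ i j : Fin n, DirichletBall.partialDeriv i (DirichletBall.partialDeriv j f) z =
      fderiv ℂ (fderiv ℂ f) z (EuclideanSpace.single i 1) (EuclideanSpace.single j 1) := by
    intro i j
    change fderiv ℂ (fun w => fderiv ℂ f w (EuclideanSpace.single j 1)) z _ = _
    rw [fderiv_clm_apply hd (differentiableAt_const _)]
    simp
  rw [key, key]
  exact (hf z hz).contDiffAt.isSymmSndFDerivAt (n := ⊤) le_top _ _

/-- Holomorphic functions on the ball, normalized to vanish outside of it. -/
def holSpace (n : ℕ) : Submodule ℂ (Cn n → ℂ) where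
  carrier := {f | IsHol f ∧ ∀ z ∉ unitBall n, f z = 0}
  add_mem' {f g} hf hg := ⟨AnalyticOnNhd.add hf.1 hg.1, fun z hz => by simp [hf.2 z hz, hg.2 z hz]⟩
  zero_mem' := ⟨analyticOnNhd_const, fun _ _ => rfl⟩
  smul_mem' c f hf := ⟨(analyticOnNhd_const.smul hf.1 : AnalyticOnNhd ℂ (fun z => c • f z) _), fun z hz => by simp [hf.2 z hz]⟩

/-- The normalization of a holomorphic function. -/
def IsHol.toHolSpace {f : Cn n → ℂ} (hf : IsHol f) : holSpace n :=
  ⟨(unitBall n).indicator f, isHol_congr hf (eqOn_indicator.symm),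
    fun _ hz => indicator_of_notMem hz _⟩

/-- The partial derivative as an endomorphism of `holSpace n`. -/
def derivEnd (i : Fin n) : Module.End ℂ (holSpace n) where
  toFun f := (f.2.1.partialDeriv i).toHolSpace
  map_add' f g := by
    ext z
    by_cases hz : z ∈ unitBall n
    · simp [IsHol.toHolSpace, hz, partialDeriv,
        fderiv_add (f.2.1.differentiableAt hz) (g.2.1.differentiableAt hz)]
    · simp [IsHol.toHolSpace, hz]
  map_smul' c f := by
    ext z
    by_cases hz : z ∈ unitBall n
    · simp [IsHol.toHolSpace, hz, partialDeriv, fderiv_const_smul (f.2.1.differentiableAt hz)]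
    · simp [IsHol.toHolSpace, hz]

lemma derivEnd_apply (i : Fin n) (f : holSpace n) {z : Cn n} (hz : z ∈ unitBall n) :
    (derivEnd i f).1 z = partialDeriv i f.1 z := by
  simp [derivEnd, IsHol.toHolSpace, hz]

/-- Commutation as endomorphisms, not merely at points of the ball, is what permits the multinomial
theorem for powers of `dirDeriv`; the normalization to zero off the ball exists for this. -/
lemma derivEnd_commute (i j : Fin n) : Commute (derivEnd (n := n) i) (derivEnd j) := by
  ext f z
  by_cases hz : z ∈ unitBall n
  · simp only [Module.End.mul_apply]
    rw [derivEnd_apply i _ hz, derivEnd_apply j _ hz,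
      partialDeriv_congr (fun w hw => derivEnd_apply j f hw) i hz,
      partialDeriv_congr (fun w hw => derivEnd_apply i f hw) j hz, f.2.1.partialDeriv_comm i j hz]
  · rw [(((derivEnd i * derivEnd j) f).2.2 z hz), (((derivEnd j * derivEnd i) f).2.2 z hz)]

lemma eqOn_derivEnd_pow (i : Fin n) (m : ℕ) {f : Cn n → ℂ} {F : holSpace n}
    (h : EqOn f F.1 (unitBall n)) :
    EqOn ((partialDeriv i)^[m] f) ((derivEnd i ^ m) F).1 (unitBall n) := by
  induction m with
  | zero => simpa using h
  | succ m ih =>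
    intro z hz
    rw [Function.iterate_succ_apply', pow_succ', Module.End.mul_apply, derivEnd_apply _ _ hz]
    exact partialDeriv_congr ih i hz

lemma iteratedPartialDeriv_eqOn (k : Fin n → ℕ) {f : Cn n → ℂ} {F : holSpace n}
    (h : EqOn f F.1 (unitBall n)) :
    EqOn (iteratedPartialDeriv k f)
      (((List.finRange n).map fun i => derivEnd i ^ k i).prod F).1 (unitBall n) := by
  unfold iteratedPartialDeriv
  induction List.finRange n with
  | nil => simpa using h
  | cons i l ih =>
    simp only [List.foldr_cons, List.map_cons, List.prod_cons, Module.End.mul_apply]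
    exact eqOn_derivEnd_pow i (k i) ih

/-- The derivative in direction `ζ`. -/
def dirDeriv (ζ : Cn n) : Module.End ℂ (holSpace n) := ∑ i, ζ i • derivEnd i

lemma sum_coord_smul_single (ζ : Cn n) : ∑ i, ζ i • (EuclideanSpace.single i (1 : ℂ) : Cn n) = ζ := by
  simpa using (EuclideanSpace.basisFun (Fin n) ℂ).sum_repr ζ

lemma dirDeriv_apply (ζ : Cn n) (F : holSpace n) {z : Cn n} (hz : z ∈ unitBall n) :
    (dirDeriv ζ F).1 z = fderiv ℂ F.1 z ζ := by
  conv_rhs => rw [← sum_coord_smul_single ζ, map_sum]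
  simp only [dirDeriv, LinearMap.sum_apply, LinearMap.smul_apply, AddSubmonoidClass.coe_finsetSum,
    Finset.sum_apply, Submodule.coe_smul, Pi.smul_apply, map_smul]
  exact Finset.sum_congr rfl fun i _ => by rw [derivEnd_apply i F hz]; rfl

lemma list_prod_smul_map {R A ι : Type*} [CommSemiring R] [Semiring A] [Algebra R A] (l : List ι)
    (c : ι → R) (a : ι → A) :
    (l.map fun i => c i • a i).prod = (l.map c).prod • (l.map a).prod := by
  induction l with
  | nil => simp
  | cons i l ih =>
    rw [List.map_cons, List.prod_cons, ih, smul_mul_smul_comm, List.map_cons, List.prod_cons,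
      List.map_cons, List.prod_cons]

/-- The multinomial theorem for commuting operators. The product is kept over the ordered list
because `iteratedPartialDeriv` is a fold over that same list. -/
lemma dirDeriv_pow (ζ : Cn n) (m : ℕ) :
    dirDeriv ζ ^ m = ∑ k ∈ Finset.univ.piAntidiag m, (Nat.multinomial Finset.univ k : ℂ) •
      monom k ζ • ((List.finRange n).map fun i => derivEnd i ^ k i).prod := by
  have hc : ((Finset.univ : Finset (Fin n)) : Set (Fin n)).Pairwise
      (Function.onFun Commute fun i => ζ i • derivEnd i) := fun i _ j _ _ =>
    ((derivEnd_commute i j).smul_left _).smul_right _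
  rw [dirDeriv, Finset.sum_pow_eq_sum_piAntidiag_of_commute _ _ hc]
  refine Finset.sum_congr rfl fun k _ => ?_
  have := Finset.noncommProd_toFinset (List.finRange n) (fun i => (ζ i • derivEnd i) ^ k i)
    (fun i _ j _ _ => (((derivEnd_commute i j).smul_left _).smul_right _).pow_pow _ _)
    (List.nodup_finRange n)
  simp only [List.toFinset_finRange] at this
  rw [this]
  simp only [smul_pow]
  rw [list_prod_smul_map]
  have hp : ((List.finRange n).map fun i => ζ i ^ k i).prod = monom k ζ := by
    rw [monom, ← List.prod_ofFn, List.ofFn_eq_map]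
  rw [hp, ← nsmul_eq_mul, Nat.cast_smul_eq_nsmul]

lemma smul_mem_unitBall {ζ : Cn n} (hζ : ζ ∈ unitSphere n) {t : ℂ} (ht : ‖t‖ < 1) :
    t • ζ ∈ unitBall n := by
  have : ‖ζ‖ = 1 := hζ
  simpa [unitBall, norm_smul, this] using ht

lemma iteratedDeriv_slice {ζ : Cn n} (hζ : ζ ∈ unitSphere n) (F : holSpace n) (m : ℕ) :
    EqOn (iteratedDeriv m fun t : ℂ => F.1 (t • ζ)) (fun t => ((dirDeriv ζ ^ m) F).1 (t • ζ))
      (Metric.ball 0 1) := by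
  induction m with
  | zero => intro t _; simp
  | succ m ih =>
    intro t ht
    rw [iteratedDeriv_succ]
    have hE := Filter.eventuallyEq_of_mem (Metric.isOpen_ball.mem_nhds ht) ih
    rw [hE.deriv_eq, pow_succ', Module.End.mul_apply]
    have hb : t • ζ ∈ unitBall n := smul_mem_unitBall hζ (by simpa using ht)
    beta_reduce
    rw [dirDeriv_apply _ _ hb]
    have h1 : HasDerivAt (fun s : ℂ => s • ζ) ζ t := by
      simpa using (hasDerivAt_id t).smul_const ζ
    exact ((((dirDeriv ζ ^ m) F).2.1.differentiableAt hb).hasFDerivAt.comp_hasDerivAt t h1).deriv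

/-- The homogeneous part of degree `m` of the power series of `f`. -/
def homPart (f : Cn n → ℂ) (m : ℕ) (ζ : Cn n) : ℂ :=
  ∑ k ∈ Finset.univ.piAntidiag m, taylorCoeff f k * monom k ζ

lemma zero_mem_unitBall : (0 : Cn n) ∈ unitBall n := by simp [unitBall]

lemma multinomial_mul_multiFactorial {k : Fin n → ℕ} {m : ℕ} (hk : len k = m) :
    Nat.multinomial Finset.univ k * multiFactorial k = m ! := by
  rw [mul_comm, ← hk]; exact Nat.multinomial_spec _ _

lemma multiFactorial_pos (k : Fin n → ℕ) : 0 < multiFactorial k :=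
  Finset.prod_pos fun _ _ => Nat.factorial_pos _

lemma mem_piAntidiag_iff {k : Fin n → ℕ} {m : ℕ} :
    k ∈ (Finset.univ : Finset (Fin n)).piAntidiag m ↔ len k = m := by
  simp [Finset.mem_piAntidiag, len]

lemma dirDeriv_pow_zero {f : Cn n → ℂ} (hf : IsHol f) (ζ : Cn n) (m : ℕ) :
    ((dirDeriv ζ ^ m) hf.toHolSpace).1 0 = m ! * homPart f m ζ := by
  rw [dirDeriv_pow, homPart, Finset.mul_sum]
  simp only [LinearMap.sum_apply, LinearMap.smul_apply, AddSubmonoidClass.coe_finsetSum,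
    Finset.sum_apply, Submodule.coe_smul, Pi.smul_apply, smul_eq_mul]
  refine Finset.sum_congr rfl fun k hk => ?_
  have hF : EqOn f hf.toHolSpace.1 (unitBall n) := eqOn_indicator.symm
  rw [← iteratedPartialDeriv_eqOn k hF zero_mem_unitBall, taylorCoeff,
    ← multinomial_mul_multiFactorial (mem_piAntidiag_iff.1 hk)]
  have : (multiFactorial k : ℂ) ≠ 0 := by exact_mod_cast (multiFactorial_pos k).ne'
  push_cast
  field_simp

/-- A holomorphic function on the ball is the sum of its homogeneous parts along each slice. -/
theorem IsHol.hasSum_homPart {f : Cn n → ℂ} (hf : IsHol f) {ζ : Cn n} (hζ : ζ ∈ unitSphere n)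
    {t : ℂ} (ht : ‖t‖ < 1) : HasSum (fun m => t ^ m * homPart f m ζ) (f (t • ζ)) := by
  set F := hf.toHolSpace
  have hd : DifferentiableOn ℂ (fun s : ℂ => F.1 (s • ζ)) (Metric.ball 0 (1 : ℝ)) := fun s hs =>
    ((F.2.1.differentiableAt (smul_mem_unitBall hζ (by simpa using hs))).comp s
      (differentiableAt_id.smul_const ζ)).differentiableWithinAt
  have h := Complex.hasSum_taylorSeries_on_ball hd
    (show t ∈ Metric.ball (0 : ℂ) (1 : ℝ) by simpa using ht)
  have hv : F.1 (t • ζ) = f (t • ζ) := indicator_of_mem (smul_mem_unitBall hζ ht) f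
  simp only [hv] at h
  have e : (fun m => t ^ m * homPart f m ζ) = fun m => (m ! : ℂ)⁻¹ • (t - 0) ^ m •
      iteratedDeriv m (fun s : ℂ => F.1 (s • ζ)) 0 := by
    funext m
    have hm : (m ! : ℂ) ≠ 0 := by exact_mod_cast m.factorial_ne_zero
    rw [iteratedDeriv_slice hζ F m (Metric.mem_ball_self one_pos)]
    beta_reduce
    rw [zero_smul, dirDeriv_pow_zero hf ζ m, smul_eq_mul, smul_eq_mul, sub_zero]
    field_simp
  rw [e]
  exact h

/-! ### The reproducing kernel and its comparison with the Riesz kernel -/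

/-- The coefficients of the reproducing kernel `∑ₘ (n+m)^{-α} (m+n-1 choose n-1) xᵐ`. -/
def kernelCoeff (n : ℕ) (α : ℝ) (m : ℕ) : ℝ :=
  ((n : ℝ) + m) ^ (-α) * ((m + (n - 1)).choose (n - 1) : ℝ)

lemma kernelCoeff_nonneg (n : ℕ) (α : ℝ) (m : ℕ) : 0 ≤ kernelCoeff n α m := by
  unfold kernelCoeff; positivity

lemma summable_kernelCoeff_mul_pow (hn : 0 < n) {α : ℝ} (hα : 0 ≤ α) {x : ℝ} (hx0 : 0 ≤ x)
    (hx : x < 1) : Summable fun m => kernelCoeff n α m * x ^ m := by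
  have hs := summable_choose_mul_geometric_of_norm_lt_one (R := ℝ) (n - 1)
    (r := x) (by rwa [Real.norm_of_nonneg hx0])
  refine Summable.of_nonneg_of_le (fun m => ?_) (fun m => ?_) hs
  · exact mul_nonneg (kernelCoeff_nonneg n α m) (pow_nonneg hx0 m)
  · refine mul_le_mul_of_nonneg_right ?_ (pow_nonneg hx0 m)
    refine mul_le_of_le_one_left (Nat.cast_nonneg _) ?_
    have : (1 : ℝ) ≤ n := by exact_mod_cast hn
    exact Real.rpow_le_one_of_one_le_of_nonpos (by linarith [m.cast_nonneg (α := ℝ)]) (by linarith)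

lemma norm_setIntegral_Ioi_le_add {F : ℝ → ℂ} {a b : ℝ} {g₁ g₂ : ℝ → ℝ} (hab : a ≤ b)
    (hg₁ : IntegrableOn g₁ (Ioc a b)) (hg₂ : IntegrableOn g₂ (Ioi b))
    (h₁ : ∀ t ∈ Ioc a b, ‖F t‖ ≤ g₁ t) (h₂ : ∀ t ∈ Ioi b, ‖F t‖ ≤ g₂ t) :
    ‖∫ t in Ioi a, F t‖ ≤ (∫ t in Ioc a b, g₁ t) + ∫ t in Ioi b, g₂ t := by
  by_cases hF : IntegrableOn F (Ioi a)
  · rw [← Ioc_union_Ioi_eq_Ioi hab, setIntegral_union (Ioc_disjoint_Ioi le_rfl) measurableSet_Ioi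
      (hF.mono_set Ioc_subset_Ioi_self) (hF.mono_set (Ioi_subset_Ioi hab))]
    exact (norm_add_le _ _).trans (add_le_add
      (norm_integral_le_of_norm_le hg₁ (ae_restrict_of_forall_mem measurableSet_Ioc h₁))
      (norm_integral_le_of_norm_le hg₂ (ae_restrict_of_forall_mem measurableSet_Ioi h₂)))
  -- A non-integrable `F` has integral `0` by convention, so the bound holds without an
  -- integrability hypothesis.
  · rw [integral_undef hF, norm_zero]
    exact add_nonneg
      (setIntegral_nonneg measurableSet_Ioc fun t ht => (norm_nonneg _).trans (h₁ t ht))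
      (setIntegral_nonneg measurableSet_Ioi fun t ht => (norm_nonneg _).trans (h₂ t ht))

lemma integrableOn_rpow_mul_exp_neg_mul {a r : ℝ} (ha : 0 < a) (hr : 0 < r) :
    IntegrableOn (fun t : ℝ => t ^ (a - 1) * Real.exp (-(r * t))) (Ioi 0) := by
  refine Integrable.of_integral_ne_zero ?_
  rw [Real.integral_rpow_mul_exp_neg_mul_Ioi ha hr]
  have := Real.Gamma_pos_of_pos ha
  positivity

/-- Write `Γ(α) (n+m)^{-α} = ∫ t^{α-1} e^{-(n+m)t} dt` and sum under the integral: the negative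
binomial series gives `e^{-nt} (1 - e^{-t} z)^{-n} = (e^t - z)^{-n}`. -/
lemma gamma_mul_tsum_kernelCoeff (hn : 0 < n) {α : ℝ} (hα : 0 < α) {z : ℂ} (hz : ‖z‖ < 1) :
    (Real.Gamma α : ℂ) * ∑' m, (kernelCoeff n α m : ℂ) * z ^ m =
      ∫ t in Ioi (0 : ℝ), ((t ^ (α - 1) : ℝ) : ℂ) * ((Real.exp t - z) ^ n)⁻¹ := by
  set F : ℕ → ℝ → ℂ := fun m t => ((t ^ (α - 1) * Real.exp (-((n + m) * t)) : ℝ) : ℂ) *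
    (((m + (n - 1)).choose (n - 1) : ℂ) * z ^ m) with hF
  have hpos : ∀ m : ℕ, (0 : ℝ) < n + m := fun m => by
    have : (0 : ℝ) < n := by exact_mod_cast hn
    positivity
  have hcoef : ∀ m : ℕ, (1 / ((n : ℝ) + m)) ^ α = ((n : ℝ) + m) ^ (-α) := fun m => by
    rw [one_div, Real.inv_rpow (hpos m).le, Real.rpow_neg (hpos m).le]
  have hint : ∀ m, IntegrableOn (F m) (Ioi 0) := fun m =>
    (integrableOn_rpow_mul_exp_neg_mul hα (hpos m)).ofReal.mul_const _
  have hval : ∀ m, ∫ t in Ioi (0 : ℝ), F m t =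
      (Real.Gamma α : ℂ) * ((kernelCoeff n α m : ℂ) * z ^ m) := fun m => by
    simp only [hF]
    rw [integral_mul_const, integral_complex_ofReal,
      Real.integral_rpow_mul_exp_neg_mul_Ioi hα (hpos m), hcoef, kernelCoeff]
    push_cast
    ring
  have hnorm : ∀ m, ∫ t in Ioi (0 : ℝ), ‖F m t‖ =
      Real.Gamma α * (kernelCoeff n α m * ‖z‖ ^ m) := fun m => by
    have : ∀ t ∈ Ioi (0 : ℝ), ‖F m t‖ = (t ^ (α - 1) * Real.exp (-((n + m) * t))) *
        (((m + (n - 1)).choose (n - 1) : ℝ) * ‖z‖ ^ m) := fun t ht => by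
      have h0 : 0 ≤ t ^ (α - 1) * Real.exp (-((n + m) * t)) :=
        mul_nonneg (Real.rpow_nonneg (le_of_lt ht) _) (Real.exp_pos _).le
      simp only [hF]
      rw [norm_mul, Complex.norm_real, Real.norm_of_nonneg h0, norm_mul, norm_pow,
        Complex.norm_natCast]
    rw [setIntegral_congr_fun measurableSet_Ioi this, integral_mul_const,
      Real.integral_rpow_mul_exp_neg_mul_Ioi hα (hpos m), hcoef, kernelCoeff]
    ring
  have hsum := hasSum_integral_of_summable_integral_norm hint (by
    simp only [hnorm]
    exact (summable_kernelCoeff_mul_pow hn hα.le (norm_nonneg z) hz).mul_left _)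
  simp only [hval] at hsum
  rw [← tsum_mul_left, hsum.tsum_eq]
  refine setIntegral_congr_fun measurableSet_Ioi fun t ht => ?_
  have ht : 0 < t := ht
  have hx : ‖(Real.exp (-t) : ℂ) * z‖ < 1 := by
    rw [norm_mul, Complex.norm_real, Real.norm_of_nonneg (Real.exp_pos _).le]
    have : Real.exp (-t) ≤ 1 := Real.exp_le_one_iff.2 (by linarith)
    nlinarith [norm_nonneg z, Real.exp_pos (-t)]
  have h := (hasSum_choose_mul_geometric_of_norm_lt_one (n - 1) hx).mul_left
    ((t ^ (α - 1) * Real.exp (-(n * t)) : ℝ) : ℂ)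
  rw [Nat.sub_add_cancel hn] at h
  have e1 : (fun m => F m t) = fun m : ℕ => ((t ^ (α - 1) * Real.exp (-(n * t)) : ℝ) : ℂ) *
      (((m + (n - 1)).choose (n - 1) : ℂ) * ((Real.exp (-t) : ℂ) * z) ^ m) := by
    funext m
    simp only [hF]
    have : Real.exp (-((n + m) * t)) = Real.exp (-(n * t)) * Real.exp (-t) ^ m := by
      rw [← Real.exp_nat_mul, ← Real.exp_add]; congr 1; ring
    rw [this]
    push_cast
    ring
  rw [e1, h.tsum_eq]
  have e2 : (1 : ℂ) - Real.exp (-t) * z = Real.exp (-t) * (Real.exp t - z) := by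
    rw [mul_sub, ← Complex.ofReal_mul, ← Real.exp_add]; simp
  have e3 : Real.exp (-(n * t)) = Real.exp (-t) ^ n := by
    rw [← Real.exp_nat_mul]; congr 1; ring
  rw [e2, e3, mul_pow, one_div, mul_inv]
  have e4 : ((Real.exp (-t) : ℝ) : ℂ) ^ n ≠ 0 :=
    pow_ne_zero _ (by exact_mod_cast (Real.exp_pos _).ne')
  push_cast at e4 ⊢
  field_simp

lemma sub_one_le_norm_exp_sub {ρ t : ℝ} (hρ0 : 0 ≤ ρ) {w : ℂ} (hw : ‖w‖ ≤ 1) :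
    Real.exp t - ρ ≤ ‖(Real.exp t : ℂ) - ρ * w‖ := by
  have h := norm_sub_norm_le (Real.exp t : ℂ) (ρ * w)
  rw [norm_mul, Complex.norm_real, Complex.norm_real, Real.norm_of_nonneg (Real.exp_pos _).le,
    Real.norm_of_nonneg hρ0] at h
  nlinarith

/-- Passing from `e^t - ρw` to `1 - w` costs at most `(e^t - 1) + (1 - ρ) = e^t - ρ`, which is
itself at most `|e^t - ρw|`. -/
lemma half_norm_le_norm_exp_sub {ρ t : ℝ} (hρ0 : 0 ≤ ρ) (hρ : ρ < 1) (ht : 0 ≤ t) {w : ℂ}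
    (hw : ‖w‖ ≤ 1) : ‖1 - w‖ / 2 ≤ ‖(Real.exp t : ℂ) - ρ * w‖ := by
  have h1 := sub_one_le_norm_exp_sub (t := t) hρ0 hw
  have h2 : (1 : ℂ) - w = ((Real.exp t : ℂ) - ρ * w) + (((1 - Real.exp t : ℝ) : ℂ) +
    ((ρ - 1 : ℝ) : ℂ) * w) := by push_cast; ring
  have h3 : ‖((1 - Real.exp t : ℝ) : ℂ) + ((ρ - 1 : ℝ) : ℂ) * w‖ ≤ Real.exp t - ρ := by
    refine (norm_add_le _ _).trans ?_
    have := Real.one_le_exp ht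
    rw [norm_mul, Complex.norm_real, Complex.norm_real, Real.norm_of_nonpos (by linarith),
      Real.norm_of_nonpos (by linarith)]
    nlinarith
  have h4 := norm_add_le ((Real.exp t : ℂ) - ρ * w) (((1 - Real.exp t : ℝ) : ℂ) +
    ((ρ - 1 : ℝ) : ℂ) * w)
  rw [← h2] at h4
  linarith

lemma integrableOn_Ioc_rpow {α δ : ℝ} (hα : 0 < α) (hδ : 0 ≤ δ) :
    IntegrableOn (fun t : ℝ => t ^ (α - 1)) (Ioc 0 δ) :=
  (intervalIntegrable_iff_integrableOn_Ioc_of_le hδ).1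
    (intervalIntegral.intervalIntegrable_rpow' (by linarith))

lemma integral_Ioc_rpow {α δ : ℝ} (hα : 0 < α) (hδ : 0 ≤ δ) :
    ∫ t in Ioc 0 δ, t ^ (α - 1) = δ ^ α / α := by
  rw [← intervalIntegral.integral_of_le hδ, integral_rpow (Or.inl (by linarith))]
  simp [Real.zero_rpow hα.ne']

/-- The bound on the kernel, with the part of the integral away from `0` left general. -/
lemma norm_gamma_mul_kernel_le (hn : 0 < n) {α ρ : ℝ} (hα : 0 < α) (hρ0 : 0 ≤ ρ) (hρ : ρ < 1)
    {w : ℂ} (hw : ‖w‖ ≤ 1) (hw1 : 1 - w ≠ 0) {g : ℝ → ℝ} (hg : IntegrableOn g (Ioi ‖1 - w‖))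
    (hgt : ∀ t ∈ Ioi ‖1 - w‖, t ^ (α - 1) * ((Real.exp t - 1) ^ n)⁻¹ ≤ g t) :
    Real.Gamma α * ‖∑' m, (kernelCoeff n α m : ℂ) * (ρ * w) ^ m‖ ≤
      2 ^ n / α * ‖1 - w‖ ^ (α - n) + ∫ t in Ioi ‖1 - w‖, g t := by
  set δ := ‖1 - w‖ with hδ
  have hδ0 : 0 < δ := norm_pos_iff.2 hw1
  have hz : ‖(ρ : ℂ) * w‖ < 1 := by
    rw [norm_mul, Complex.norm_real, Real.norm_of_nonneg hρ0]; nlinarith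
  have h1 : Real.Gamma α * ‖∑' m, (kernelCoeff n α m : ℂ) * (ρ * w) ^ m‖ =
      ‖(Real.Gamma α : ℂ) * ∑' m, (kernelCoeff n α m : ℂ) * (ρ * w) ^ m‖ := by
    rw [norm_mul, Complex.norm_real, Real.norm_of_nonneg (Real.Gamma_pos_of_pos hα).le]
  have hnorm : ∀ t : ℝ, 0 < t → ‖((t ^ (α - 1) : ℝ) : ℂ) * ((Real.exp t - ρ * w) ^ n)⁻¹‖ =
      t ^ (α - 1) * (‖(Real.exp t : ℂ) - ρ * w‖ ^ n)⁻¹ := fun t ht => by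
    rw [norm_mul, Complex.norm_real, Real.norm_of_nonneg (Real.rpow_nonneg ht.le _), norm_inv,
      norm_pow]
  rw [h1, gamma_mul_tsum_kernelCoeff hn hα hz]
  -- The integral is split at `δ = |1 - w|`: below it `|e^t - ρw| ≥ δ/2`, above it `|e^t - ρw| ≥ e^t
  -- - 1`. Neither bound involves `ρ`.
  refine (norm_setIntegral_Ioi_le_add (g₁ := fun t => t ^ (α - 1) * ((δ / 2) ^ n)⁻¹) (g₂ := g)
    hδ0.le ((integrableOn_Ioc_rpow hα hδ0.le).mul_const _) hg (fun t ht => ?_)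
    (fun t ht => ?_)).trans ?_
  · rw [hnorm t ht.1]
    have := half_norm_le_norm_exp_sub hρ0 hρ ht.1.le hw
    have := Real.rpow_nonneg ht.1.le (α - 1)
    gcongr
  · have ht0 : 0 < t := hδ0.trans ht
    rw [hnorm t ht0]
    refine le_trans ?_ (hgt t ht)
    have h2 := sub_one_le_norm_exp_sub (t := t) hρ0 hw
    have h3 : 0 < Real.exp t - 1 := by linarith [Real.add_one_lt_exp ht0.ne']
    have := Real.rpow_nonneg ht0.le (α - 1)
    gcongr
    linarith
  · rw [integral_mul_const, integral_Ioc_rpow hα hδ0.le, Real.rpow_sub hδ0, Real.rpow_natCast, div_pow]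
    apply le_of_eq
    field_simp

lemma kernel_bound_of_lt (hn : 0 < n) {α : ℝ} (hα : 0 < α) (hαn : α < n) :
    ∃ C : ℝ, 0 < C ∧ ∀ ρ : ℝ, 0 ≤ ρ → ρ < 1 → ∀ w : ℂ, ‖w‖ ≤ 1 → 1 - w ≠ 0 →
      ‖∑' m, (kernelCoeff n α m : ℂ) * (ρ * w) ^ m‖ ≤ C * ‖1 - w‖ ^ (α - n) := by
  have hG := Real.Gamma_pos_of_pos hα
  have hd : 0 < n - α := by linarith
  refine ⟨(2 ^ n / α + 1 / (n - α)) / Real.Gamma α, by positivity,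
    fun ρ hρ0 hρ w hw hw1 => ?_⟩
  have hδ0 : 0 < ‖1 - w‖ := norm_pos_iff.2 hw1
  have key := norm_gamma_mul_kernel_le hn hα hρ0 hρ hw hw1 (g := fun t => t ^ (α - 1 - n))
    (integrableOn_Ioi_rpow_of_lt (by linarith) hδ0) (fun t ht => by
      have ht0 : 0 < t := hδ0.trans ht
      rw [Real.rpow_sub ht0 (α - 1), Real.rpow_natCast, div_eq_mul_inv]
      have h3 : t ≤ Real.exp t - 1 := by linarith [Real.add_one_le_exp t]
      gcongr)
  rw [integral_Ioi_rpow_of_lt (by linarith) hδ0] at key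
  rw [div_mul_eq_mul_div, le_div_iff₀ hG, mul_comm]
  refine key.trans (le_of_eq ?_)
  rw [show α - 1 - n + 1 = α - n by ring, add_mul, ← neg_sub (n : ℝ) α, neg_div_neg_eq]
  ring

lemma integral_Ioi_inv_exp_sub_one {δ : ℝ} (hδ : 0 < δ) :
    IntegrableOn (fun t => (Real.exp t - 1)⁻¹) (Ioi δ) ∧
      ∫ t in Ioi δ, (Real.exp t - 1)⁻¹ = -Real.log (1 - Real.exp (-δ)) := by
  have hpos : ∀ t : ℝ, 0 < t → 0 < 1 - Real.exp (-t) := fun t ht => by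
    have := Real.exp_lt_exp.2 (neg_lt_zero.2 ht)
    rw [Real.exp_zero] at this
    linarith
  have hd : ∀ t ∈ Ici δ, HasDerivAt (fun t => Real.log (1 - Real.exp (-t)))
      ((Real.exp t - 1)⁻¹) t := fun t ht => by
    have ht0 : 0 < t := hδ.trans_le ht
    have h := (((hasDerivAt_neg t).exp).const_sub 1).log (hpos t ht0).ne'
    convert h using 1
    have : Real.exp t - 1 = Real.exp t * (1 - Real.exp (-t)) := by
      rw [mul_sub, ← Real.exp_add]; simp
    rw [this, Real.exp_neg]
    have := hpos t ht0
    rw [Real.exp_neg] at this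
    have := Real.exp_pos t
    field_simp
  have hn : ∀ t ∈ Ioi δ, 0 ≤ (Real.exp t - 1)⁻¹ := fun t ht =>
    inv_nonneg.2 (by linarith [Real.one_le_exp (hδ.le.trans (le_of_lt ht))])
  have hl : Tendsto (fun t => Real.log (1 - Real.exp (-t))) atTop (𝓝 0) := by
    have : Tendsto (fun t : ℝ => 1 - Real.exp (-t)) atTop (𝓝 1) := by
      simpa using (Real.tendsto_exp_neg_atTop_nhds_zero).const_sub 1
    simpa using this.log one_ne_zero
  exact ⟨integrableOn_Ioi_deriv_of_nonneg' hd hn hl,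
    by simpa using integral_Ioi_of_hasDerivAt_of_nonneg' hd hn hl⟩

/-- For `α = n` the majorant `t^{α-1-n} = 1/t` is not integrable at infinity, so one factor `(e^t -
1)⁻¹` is kept; its integral produces the logarithm. -/
lemma kernel_bound_of_eq (hn : 0 < n) :
    ∃ C : ℝ, 0 < C ∧ ∀ ρ : ℝ, 0 ≤ ρ → ρ < 1 → ∀ w : ℂ, ‖w‖ ≤ 1 → 1 - w ≠ 0 →
      ‖∑' m, (kernelCoeff n n m : ℂ) * (ρ * w) ^ m‖ ≤ C * Real.log (Real.exp 1 / ‖1 - w‖) := by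
  have hn' : (0 : ℝ) < n := by exact_mod_cast hn
  have hG := Real.Gamma_pos_of_pos hn'
  -- With `L = log (e/δ)` and `δ ≤ 2` one has `L ≥ 0.3`, so `1 ≤ 4L`, and `-log (1 - e^{-δ}) ≤ log 3
  -- - log δ ≤ 3L`.
  refine ⟨(2 ^ n / n * 4 + 3) / Real.Gamma n, by positivity, fun ρ hρ0 hρ w hw hw1 => ?_⟩
  have hδ0 : 0 < ‖1 - w‖ := norm_pos_iff.2 hw1
  have hδ2 : ‖1 - w‖ ≤ 2 := (norm_sub_le _ _).trans (by rw [norm_one]; linarith)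
  have key := norm_gamma_mul_kernel_le hn hn' hρ0 hρ hw hw1
    (integral_Ioi_inv_exp_sub_one hδ0).1 (fun t ht => by
      have ht0 : 0 < t := hδ0.trans ht
      have h3 : t ≤ Real.exp t - 1 := by linarith [Real.add_one_le_exp t]
      obtain ⟨k, rfl⟩ : ∃ k, n = k + 1 := ⟨n - 1, by omega⟩
      have e : t ^ (((k + 1 : ℕ) : ℝ) - 1) = t ^ k := by
        rw [← Real.rpow_natCast]; congr 1; push_cast; ring
      have h4 : 0 < Real.exp t - 1 := ht0.trans_le h3
      rw [e, pow_succ, mul_inv, ← mul_assoc]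
      refine mul_le_of_le_one_left (inv_nonneg.2 h4.le) ?_
      rw [← div_eq_mul_inv, div_le_one (by positivity)]
      gcongr)
  rw [(integral_Ioi_inv_exp_sub_one hδ0).2, sub_self, Real.rpow_zero, mul_one] at key
  rw [div_mul_eq_mul_div, le_div_iff₀ hG, mul_comm]
  refine key.trans ?_
  set δ := ‖1 - w‖
  have h1 : δ / 3 ≤ 1 - Real.exp (-δ) := by
    have h := Real.add_one_le_exp δ
    have h2 : Real.exp (-δ) ≤ (1 + δ)⁻¹ := by
      rw [Real.exp_neg]; exact inv_anti₀ (by positivity) (by linarith)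
    have h3 : (1 + δ)⁻¹ ≤ 1 - δ / 3 := by
      rw [inv_le_iff_one_le_mul₀ (by positivity)]; nlinarith
    linarith
  have h2 := Real.log_le_log (by positivity) h1
  rw [Real.log_div hδ0.ne' (by norm_num)] at h2
  have h3 : Real.log 3 ≤ 1.4 := by
    have : Real.log 3 ≤ Real.log (2 ^ 2) := Real.log_le_log (by norm_num) (by norm_num)
    rw [Real.log_pow] at this
    have := Real.log_two_lt_d9
    push_cast at *
    linarith
  have h4 : Real.log δ ≤ 0.7 := (Real.log_le_log hδ0 hδ2).trans
    (by linarith [Real.log_two_lt_d9])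
  rw [Real.log_div (Real.exp_pos 1).ne' hδ0.ne', Real.log_exp]
  have h5 : (0 : ℝ) < 2 ^ n / n := by positivity
  nlinarith

theorem exists_kernel_bound (hn : 0 < n) {α : ℝ} (hα : 0 < α) (hαn : α ≤ n) :
    ∃ C : ℝ, 0 < C ∧ ∀ ρ : ℝ, 0 ≤ ρ → ρ < 1 → ∀ w : ℂ, ‖w‖ ≤ 1 →
      ‖∑' m, (kernelCoeff n α m : ℂ) * (ρ * w) ^ m‖ₑ ≤
        ENNReal.ofReal C * rieszKernel n α ‖1 - w‖ := by
  rcases hαn.lt_or_eq with h | h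
  · obtain ⟨C, hC, hb⟩ := kernel_bound_of_lt hn hα h
    refine ⟨C, hC, fun ρ hρ0 hρ w hw => ?_⟩
    -- At `w = 1` the right side is `C * ∞ = ∞`, because `C > 0`.
    by_cases hw1 : 1 - w = 0
    · simp [hw1, rieszKernel, ENNReal.mul_top, hC]
    · rw [rieszKernel, if_neg (norm_ne_zero_iff.2 hw1), if_neg h.ne, ← ENNReal.ofReal_mul hC.le,
        ← ofReal_norm]
      exact ENNReal.ofReal_le_ofReal (hb ρ hρ0 hρ w hw hw1)
  · subst h
    obtain ⟨C, hC, hb⟩ := kernel_bound_of_eq hn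
    refine ⟨C, hC, fun ρ hρ0 hρ w hw => ?_⟩
    by_cases hw1 : 1 - w = 0
    · simp [hw1, rieszKernel, ENNReal.mul_top, hC]
    · rw [rieszKernel, if_neg (norm_ne_zero_iff.2 hw1), if_pos rfl, ← ENNReal.ofReal_mul hC.le,
        ← ofReal_norm]
      exact ENNReal.ofReal_le_ofReal (hb ρ hρ0 hρ w hw hw1)

/-! ### Moments of measures on the sphere and the energy -/

lemma continuous_monom (k : Fin n → ℕ) : Continuous (monom k) := by
  unfold monom; fun_prop

lemma norm_monom_le_one (k : Fin n → ℕ) {z : Cn n} (hz : ‖z‖ ≤ 1) : ‖monom k z‖ ≤ 1 := by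
  rw [monom, norm_prod]
  refine Finset.prod_le_one (fun _ _ => norm_nonneg _) fun i _ => ?_
  rw [norm_pow]
  exact pow_le_one₀ (norm_nonneg _) ((PiLp.norm_apply_le z i).trans hz)

lemma inner_pow_eq_sum (w z : Cn n) (m : ℕ) :
    inner ℂ w z ^ m = ∑ k ∈ Finset.univ.piAntidiag m,
      (Nat.multinomial Finset.univ k : ℂ) * ((starRingEnd ℂ) (monom k w) * monom k z) := by
  have h : inner ℂ w z = ∑ i, (starRingEnd ℂ) (w i) * z i := by
    simp [PiLp.inner_apply, mul_comm]
  rw [h, Finset.sum_pow_eq_sum_piAntidiag]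
  simp [monom, mul_pow, Finset.prod_mul_distrib]

lemma weight_pos (hn : 0 < n) (α : ℝ) (k : Fin n → ℕ) : 0 < weight α k := by
  have : (0 : ℝ) < n := by exact_mod_cast hn
  have : (0 : ℝ) < multiFactorial k := by exact_mod_cast multiFactorial_pos k
  unfold weight
  positivity

/-- This factorization makes the reproducing kernel a power series in `⟨z,w⟩` alone, since `⟨z,w⟩^m`
is the multinomial sum over `|k| = m`. -/
lemma inv_weight (hn : 0 < n) (α : ℝ) {k : Fin n → ℕ} {m : ℕ} (hk : len k = m) :
    (weight α k)⁻¹ = kernelCoeff n α m * Nat.multinomial Finset.univ k := by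
  have h1 : (Nat.multinomial Finset.univ k : ℝ) * multiFactorial k = m ! := by
    exact_mod_cast multinomial_mul_multiFactorial hk
  have h2 : (((m + (n - 1)).choose (n - 1) : ℕ) : ℝ) * (n - 1)! * m ! = (n - 1 + m)! := by
    have := Nat.choose_mul_factorial_mul_factorial (n := m + (n - 1)) (k := n - 1) (by omega)
    rw [Nat.add_sub_cancel] at this
    rw [add_comm (n - 1) m]
    exact_mod_cast this
  have hb : (0 : ℝ) < n + m := by
    have : (0 : ℝ) < n := by exact_mod_cast hn
    positivity
  have h3 : ((n - 1 + m)! : ℝ) ≠ 0 := by exact_mod_cast Nat.factorial_ne_zero _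
  have h4 := (Real.rpow_pos_of_pos hb α).ne'
  refine inv_eq_of_mul_eq_one_right ?_
  rw [weight, kernelCoeff, hk, Real.rpow_neg hb.le]
  field_simp
  rw [← h2, ← h1]
  ring

/-- The holomorphic moments `∫ ζᵏ dμ`. -/
def moment (μ : Measure (Cn n)) (k : Fin n → ℕ) : ℂ := ∫ ζ, monom k ζ ∂μ

/-- The energy of degree `m`: `∬ ⟨ζ,η⟩ᵐ dμ dμ`, written through the moments. -/
def momentEnergy (μ : Measure (Cn n)) (m : ℕ) : ℝ :=
  ∑ k ∈ Finset.univ.piAntidiag m, (Nat.multinomial Finset.univ k : ℝ) * ‖moment μ k‖ ^ 2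

lemma momentEnergy_nonneg (μ : Measure (Cn n)) (m : ℕ) : 0 ≤ momentEnergy μ m :=
  Finset.sum_nonneg fun _ _ => by positivity

section Sphere

variable {μ : Measure (Cn n)} [IsFiniteMeasure μ]

lemma integrable_monom (hμ : ∀ᵐ ζ ∂μ, ζ ∈ unitSphere n) (k : Fin n → ℕ) :
    Integrable (monom k) μ :=
  Integrable.of_bound (continuous_monom k).aestronglyMeasurable 1
    (hμ.mono fun _ hζ => norm_monom_le_one k (le_of_eq hζ))

lemma integral_inner_pow (hμ : ∀ᵐ ζ ∂μ, ζ ∈ unitSphere n) (m : ℕ) :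
    ∫ p : Cn n × Cn n, inner ℂ p.1 p.2 ^ m ∂μ.prod μ = momentEnergy μ m := by
  simp only [inner_pow_eq_sum]
  have hi : ∀ k : Fin n → ℕ, Integrable (fun p : Cn n × Cn n =>
      (Nat.multinomial Finset.univ k : ℂ) * ((starRingEnd ℂ) (monom k p.1) * monom k p.2))
      (μ.prod μ) := fun k =>
    (Integrable.mul_prod (f := fun z => (starRingEnd ℂ) (monom k z))
      (Integrable.of_bound (Complex.continuous_conj.comp
        (continuous_monom k)).aestronglyMeasurable 1 (hμ.mono fun _ hζ => by
          rw [RCLike.norm_conj]; exact norm_monom_le_one k (le_of_eq hζ)))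
      (integrable_monom hμ k)).const_mul _
  rw [integral_finsetSum _ fun k _ => hi k, momentEnergy]
  push_cast
  refine Finset.sum_congr rfl fun k _ => ?_
  rw [integral_const_mul, integral_prod_mul (fun z => (starRingEnd ℂ) (monom k z)), integral_conj,
    ← moment, ← Complex.normSq_eq_conj_mul_self, Complex.normSq_eq_norm_sq]
  push_cast
  ring

lemma norm_inner_le_one {z w : Cn n} (hz : z ∈ unitSphere n) (hw : w ∈ unitSphere n) :
    ‖(inner ℂ z w : ℂ)‖ ≤ 1 := by
  have h := norm_inner_le_norm (𝕜 := ℂ) z w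
  rwa [show ‖z‖ = 1 from hz, show ‖w‖ = 1 from hw, one_mul] at h

/-- For `ρ < 1` the series converges absolutely and uniformly on the sphere, so it may be integrated
term by term. -/
lemma hasSum_momentEnergy (hn : 0 < n) {α : ℝ} (hα : 0 ≤ α) {ρ : ℝ} (hρ0 : 0 ≤ ρ) (hρ : ρ < 1)
    (hμ : ∀ᵐ ζ ∂μ, ζ ∈ unitSphere n) :
    HasSum (fun m => ((kernelCoeff n α m * ρ ^ m * momentEnergy μ m : ℝ) : ℂ))
      (∫ p : Cn n × Cn n, ∑' m, (kernelCoeff n α m : ℂ) * (ρ * inner ℂ p.1 p.2) ^ m ∂μ.prod μ) := by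
  set F : ℕ → Cn n × Cn n → ℂ := fun m p => (kernelCoeff n α m : ℂ) * (ρ * inner ℂ p.1 p.2) ^ m
  have hb : ∀ m, ∀ᵐ p ∂μ.prod μ, ‖F m p‖ ≤ kernelCoeff n α m * ρ ^ m := fun m => by
    filter_upwards [Measure.quasiMeasurePreserving_fst.ae hμ,
      Measure.quasiMeasurePreserving_snd.ae hμ] with p h1 h2
    simp only [F]
    rw [norm_mul, norm_pow, norm_mul, Complex.norm_real, Complex.norm_real,
      Real.norm_of_nonneg (kernelCoeff_nonneg n α m), Real.norm_of_nonneg hρ0]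
    have := norm_inner_le_one h1 h2
    have := kernelCoeff_nonneg n α m
    gcongr
    exact mul_le_of_le_one_right hρ0 (by assumption)
  have hi : ∀ m, Integrable (F m) (μ.prod μ) := fun m =>
    Integrable.of_bound (Continuous.aestronglyMeasurable (by fun_prop)) _ (hb m)
  have hs : Summable fun m => ∫ p, ‖F m p‖ ∂μ.prod μ := by
    refine Summable.of_nonneg_of_le (fun m => integral_nonneg fun _ => norm_nonneg _) (fun m => ?_)
      ((summable_kernelCoeff_mul_pow hn hα hρ0 hρ).mul_right ((μ.prod μ).real univ))
    have := norm_integral_le_of_norm_le_const ((hb m).mono fun p hp => (norm_norm (F m p)).trans_le hp)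
    exact (Real.le_norm_self _).trans this
  have h := hasSum_integral_of_summable_integral_norm hi hs
  have e : ∀ m, ∫ p, F m p ∂μ.prod μ =
      ((kernelCoeff n α m * ρ ^ m * momentEnergy μ m : ℝ) : ℂ) := fun m => by
    simp only [F, mul_pow, ← mul_assoc]
    rw [integral_const_mul, integral_inner_pow hμ]
    push_cast
    ring
  simpa only [e] using h

/-- The sum defining the squared norm of `g ↦ ∫ g dμ` is controlled by the Riesz energy. -/
lemma exists_sum_momentEnergy_le (hn : 0 < n) {α : ℝ} (hα : 0 < α) (hαn : α ≤ n)
    (hμ : ∀ᵐ ζ ∂μ, ζ ∈ unitSphere n) (hE : rieszEnergy α μ < ∞) :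
    ∃ B : ℝ, ∀ ρ : ℝ, 0 ≤ ρ → ρ < 1 → ∀ M : ℕ,
      ∑ m ∈ Finset.range M, kernelCoeff n α m * ρ ^ m * momentEnergy μ m ≤ B := by
  obtain ⟨C, hC, hb⟩ := exists_kernel_bound hn hα hαn
  refine ⟨(ENNReal.ofReal C * rieszEnergy α μ).toReal, fun ρ hρ0 hρ M => ?_⟩
  have hsum := hasSum_momentEnergy hn hα.le hρ0 hρ hμ
  have hre := Complex.hasSum_re hsum
  simp only [Complex.ofReal_re] at hre
  refine (sum_le_hasSum _ (fun m _ => mul_nonneg (mul_nonneg (kernelCoeff_nonneg n α m)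
    (pow_nonneg hρ0 m)) (momentEnergy_nonneg μ m)) hre).trans ?_
  refine (Complex.re_le_norm _).trans ?_
  rw [← toReal_enorm]
  refine ENNReal.toReal_mono (ENNReal.mul_ne_top ENNReal.ofReal_ne_top hE.ne) ?_
  -- The resulting bound does not depend on `ρ` or `M`.
  refine (enorm_integral_le_lintegral_enorm _).trans ((lintegral_prod_le _).trans ?_)
  rw [rieszEnergy, ← lintegral_const_mul' _ _ ENNReal.ofReal_ne_top]
  refine lintegral_mono_ae (hμ.mono fun η hη => ?_)
  rw [← lintegral_const_mul' _ _ ENNReal.ofReal_ne_top]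
  exact lintegral_mono_ae (hμ.mono fun ζ hζ => hb ρ hρ0 hρ _ (norm_inner_le_one hη hζ))

/-! ### Integrals of dilations against measures of finite energy -/

lemma norm_sum_mul_sq_le (hn : 0 < n) (α : ℝ) (S : Finset (Fin n → ℕ)) (a b : (Fin n → ℕ) → ℂ) :
    ‖∑ k ∈ S, a k * b k‖ ^ 2 ≤
      (∑ k ∈ S, weight α k * ‖a k‖ ^ 2) * ∑ k ∈ S, (weight α k)⁻¹ * ‖b k‖ ^ 2 := by
  have h1 : ‖∑ k ∈ S, a k * b k‖ ≤
      ∑ k ∈ S, (√(weight α k) * ‖a k‖) * ((√(weight α k))⁻¹ * ‖b k‖) := by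
    refine (norm_sum_le _ _).trans (le_of_eq (Finset.sum_congr rfl fun k _ => ?_))
    have := (Real.sqrt_pos.2 (weight_pos hn α k)).ne'
    rw [norm_mul]
    field_simp
  refine (pow_le_pow_left₀ (norm_nonneg _) h1 2).trans
    ((Finset.sum_mul_sq_le_sq_mul_sq S _ _).trans (le_of_eq ?_))
  have hs := fun k => Real.sq_sqrt (weight_pos hn α k).le
  simp only [mul_pow, inv_pow, hs]

lemma sum_weight_mul_le {α : ℝ} (hn : 0 < n) {u : Cn n → ℂ} {D : ℝ} (hD0 : 0 ≤ D)
    (hD : ∑' k : Fin n → ℕ, ENNReal.ofReal (weight α k * ‖taylorCoeff u k‖ ^ 2) ≤ ENNReal.ofReal D)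
    (S : Finset (Fin n → ℕ)) : ∑ k ∈ S, weight α k * ‖taylorCoeff u k‖ ^ 2 ≤ D := by
  rw [← ENNReal.ofReal_le_ofReal_iff hD0, ENNReal.ofReal_sum_of_nonneg
    fun k _ => mul_nonneg (weight_pos hn α k).le (sq_nonneg _)]
  exact (ENNReal.sum_le_tsum S).trans hD

lemma sum_inv_weight_mul (hn : 0 < n) (α : ℝ) (m : ℕ) (x : (Fin n → ℕ) → ℝ) :
    ∑ k ∈ Finset.univ.piAntidiag m, (weight α k)⁻¹ * x k = kernelCoeff n α m *
      ∑ k ∈ Finset.univ.piAntidiag m, (Nat.multinomial Finset.univ k : ℝ) * x k := by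
  rw [Finset.mul_sum]
  refine Finset.sum_congr rfl fun k hk => ?_
  rw [inv_weight hn α (mem_piAntidiag_iff.1 hk), mul_assoc]

lemma sum_multinomial_mul_norm_monom_sq {ζ : Cn n} (hζ : ζ ∈ unitSphere n) (m : ℕ) :
    ∑ k ∈ Finset.univ.piAntidiag m, (Nat.multinomial Finset.univ k : ℝ) * ‖monom k ζ‖ ^ 2 = 1 := by
  have h := inner_pow_eq_sum ζ ζ m
  rw [inner_self_eq_norm_sq_to_K, show ‖ζ‖ = 1 from hζ] at h
  simp only [← Complex.normSq_eq_conj_mul_self, Complex.normSq_eq_norm_sq] at h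
  have h' : ((∑ k ∈ Finset.univ.piAntidiag m,
    (Nat.multinomial Finset.univ k : ℝ) * ‖monom k ζ‖ ^ 2 : ℝ) : ℂ) = 1 := by
    push_cast at h ⊢
    simpa using h.symm
  exact_mod_cast h'

/-- A crude consequence of `|homPart|² ≤ D c_m`, with `c_m` the kernel coefficient; it serves only
to justify exchanging sum and integral. -/
lemma norm_homPart_le {α : ℝ} (hn : 0 < n) {u : Cn n → ℂ} {D : ℝ} (hD0 : 0 ≤ D)
    (hD : ∑' k : Fin n → ℕ, ENNReal.ofReal (weight α k * ‖taylorCoeff u k‖ ^ 2) ≤ ENNReal.ofReal D)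
    {ζ : Cn n} (hζ : ζ ∈ unitSphere n) (m : ℕ) : ‖homPart u m ζ‖ ≤ D + kernelCoeff n α m := by
  have h := norm_sum_mul_sq_le hn α (Finset.univ.piAntidiag m) (taylorCoeff u) (fun k => monom k ζ)
  rw [sum_inv_weight_mul hn, sum_multinomial_mul_norm_monom_sq hζ, mul_one] at h
  have h0 := kernelCoeff_nonneg n α m
  have h1 := h.trans (mul_le_mul_of_nonneg_right (sum_weight_mul_le hn hD0 hD _) h0)
  change ‖homPart u m ζ‖ ^ 2 ≤ _ at h1
  exact abs_le_of_sq_le_sq' (by nlinarith) (by positivity) |>.2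

/-- Integration over dilations is bounded on `D_α` uniformly in `r`: weighted Cauchy–Schwarz,
applied to partial sums over degrees below `M`. -/
lemma norm_integral_dilation_sq_le (hn : 0 < n) {α : ℝ} (hα : 0 < α)
    (hμ : ∀ᵐ ζ ∂μ, ζ ∈ unitSphere n) {B : ℝ}
    (hB : ∀ ρ : ℝ, 0 ≤ ρ → ρ < 1 → ∀ M : ℕ,
      ∑ m ∈ Finset.range M, kernelCoeff n α m * ρ ^ m * momentEnergy μ m ≤ B)
    {u : Cn n → ℂ} (hu : IsHol u) {D : ℝ} (hD0 : 0 ≤ D)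
    (hD : ∑' k : Fin n → ℕ, ENNReal.ofReal (weight α k * ‖taylorCoeff u k‖ ^ 2) ≤ ENNReal.ofReal D)
    {r : ℝ} (hr0 : 0 ≤ r) (hr : r < 1) : ‖∫ ζ, u ((r : ℂ) • ζ) ∂μ‖ ^ 2 ≤ D * B := by
  set F : ℕ → Cn n → ℂ := fun m ζ => (r : ℂ) ^ m * homPart u m ζ
  have hrn : ‖(r : ℂ)‖ = r := by rw [Complex.norm_real, Real.norm_of_nonneg hr0]
  have hb : ∀ m, ∀ᵐ ζ ∂μ, ‖F m ζ‖ ≤ D * r ^ m + kernelCoeff n α m * r ^ m := fun m =>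
    hμ.mono fun ζ hζ => by
      simp only [F]
      rw [norm_mul, norm_pow, hrn, ← add_mul, mul_comm]
      have := norm_homPart_le hn hD0 hD hζ m
      gcongr
  have hc : ∀ m, Continuous (homPart u m) := fun m =>
    continuous_finsetSum _ fun k _ => continuous_const.mul (continuous_monom k)
  have hi : ∀ m, Integrable (F m) μ := fun m =>
    Integrable.of_bound (continuous_const.mul (hc m)).aestronglyMeasurable _ (hb m)
  have hs : Summable fun m => ∫ ζ, ‖F m ζ‖ ∂μ := by
    refine Summable.of_nonneg_of_le (fun m => integral_nonneg fun _ => norm_nonneg _) (fun m => ?_)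
      ((((summable_geometric_of_lt_one hr0 hr).mul_left D).add
        (summable_kernelCoeff_mul_pow hn hα.le hr0 hr)).mul_right (μ.real univ))
    have := norm_integral_le_of_norm_le_const ((hb m).mono fun p hp => (norm_norm (F m p)).trans_le hp)
    exact (Real.le_norm_self _).trans this
  have h := hasSum_integral_of_summable_integral_norm hi hs
  have e : ∫ ζ, ∑' m, F m ζ ∂μ = ∫ ζ, u ((r : ℂ) • ζ) ∂μ :=
    integral_congr_ae (hμ.mono fun ζ hζ => (hu.hasSum_homPart hζ (by rwa [hrn])).tsum_eq)
  rw [e] at h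
  have eF : ∀ m, ∫ ζ, F m ζ ∂μ =
      ∑ k ∈ Finset.univ.piAntidiag m, taylorCoeff u k * ((r : ℂ) ^ len k * moment μ k) := fun m => by
    simp only [F, homPart]
    rw [integral_const_mul, integral_finsetSum _ fun k _ => (integrable_monom hμ k).const_mul _,
      Finset.mul_sum]
    refine Finset.sum_congr rfl fun k hk => ?_
    rw [integral_const_mul, mem_piAntidiag_iff.1 hk, ← moment]
    ring
  simp only [eF] at h
  refine le_of_tendsto (h.tendsto_sum_nat.norm.pow 2) (Eventually.of_forall fun M => ?_)
  have hdisj : ((Finset.range M : Finset ℕ) : Set ℕ).PairwiseDisjoint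
      fun m => (Finset.univ : Finset (Fin n)).piAntidiag m := fun i _ j _ hij =>
    Finset.disjoint_left.2 fun k hk hk' =>
      hij ((mem_piAntidiag_iff.1 hk).symm.trans (mem_piAntidiag_iff.1 hk'))
  rw [← Finset.sum_biUnion hdisj]
  refine (norm_sum_mul_sq_le hn α _ _ _).trans (mul_le_mul (sum_weight_mul_le hn hD0 hD _) ?_
    (Finset.sum_nonneg fun k _ => mul_nonneg (inv_nonneg.2 (weight_pos hn α k).le) (sq_nonneg _))
    hD0)
  rw [Finset.sum_biUnion hdisj]
  refine le_trans (le_of_eq (Finset.sum_congr rfl fun m _ => ?_))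
    -- Squaring the moments turns `r^m` into `(r²)^m`, hence `ρ = r²`.
    (hB (r ^ 2) (by positivity) (by nlinarith) M)
  rw [sum_inv_weight_mul hn, momentEnergy, mul_assoc, Finset.mul_sum (a := (r ^ 2) ^ m)]
  congr 1
  refine Finset.sum_congr rfl fun k hk => ?_
  rw [norm_mul, norm_pow, hrn, mem_piAntidiag_iff.1 hk]
  ring

end Sphere

/-! ### The constant function `1` belongs to every Dirichlet-type space -/

lemma iteratedPartialDeriv_const (k : Fin n → ℕ) (c : ℂ) :
    iteratedPartialDeriv k (fun _ : Cn n => c) = fun _ => if ∀ i, k i = 0 then c else 0 := by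
  have hp : ∀ (i : Fin n) (c : ℂ), partialDeriv i (fun _ : Cn n => c) = fun _ => 0 := fun i c => by
    funext z; simp [partialDeriv]
  have hit : ∀ (i : Fin n) (m : ℕ) (c : ℂ), (partialDeriv i)^[m] (fun _ : Cn n => c) =
      fun _ => if m = 0 then c else 0 := fun i m => by
    induction m with
    | zero => intro c; simp
    | succ m ih =>
      intro c
      rw [Function.iterate_succ_apply, hp, ih]
      simp
  have hl : ∀ l : List (Fin n), l.foldr (fun i g => (partialDeriv i)^[k i] g) (fun _ => c) =
      fun _ : Cn n => if ∀ i ∈ l, k i = 0 then c else 0 := fun l => by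
    induction l with
    | nil => simp
    | cons i l ih =>
      rw [List.foldr_cons, ih, hit]
      funext z
      by_cases hi : k i = 0 <;> simp [hi]
  rw [iteratedPartialDeriv, hl]
  simp

lemma one_mem_dirichletSpace (n : ℕ) (α : ℝ) : (1 : Cn n → ℂ) ∈ dirichletSpace n α := by
  refine ⟨analyticOnNhd_const, ?_⟩
  have h0 : ∀ k : Fin n → ℕ, k ≠ 0 → taylorCoeff (1 : Cn n → ℂ) k = 0 := fun k hk => by
    have := congrFun (iteratedPartialDeriv_const k 1) 0
    rw [taylorCoeff, show (1 : Cn n → ℂ) = fun _ => 1 from rfl, this,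
      if_neg fun h : ∀ i, k i = 0 => hk (funext h), zero_div]
  rw [dirichletNorm, tsum_eq_single 0 fun k hk => by simp [h0 k hk]]
  exact ENNReal.rpow_lt_top_of_nonneg (by norm_num) ENNReal.ofReal_ne_top

/-! ### Non-cyclicity -/

lemma tsum_le_of_dirichletNorm_lt {α : ℝ} {u : Cn n → ℂ} {ε : ℝ} (hε : 0 ≤ ε)
    (h : dirichletNorm α u < ENNReal.ofReal ε) :
    ∑' k : Fin n → ℕ, ENNReal.ofReal (weight α k * ‖taylorCoeff u k‖ ^ 2) ≤
      ENNReal.ofReal (ε ^ 2) := by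
  have h1 := ENNReal.rpow_le_rpow h.le (by norm_num : (0 : ℝ) ≤ 2)
  rw [dirichletNorm, ← ENNReal.rpow_mul] at h1
  rw [ENNReal.ofReal_pow hε]
  simpa using h1

lemma isCompact_unitSphere : IsCompact (unitSphere n) := by
  have : unitSphere n = Metric.sphere 0 1 := by ext; simp [unitSphere]
  rw [this]
  exact isCompact_sphere 0 1

lemma IsHol.continuousOn_dilation {f : Cn n → ℂ} (hf : IsHol f) {r : ℝ} (hr0 : 0 ≤ r)
    (hr : r < 1) : ContinuousOn (fun ζ => f ((r : ℂ) • ζ)) (unitSphere n) :=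
  (AnalyticOnNhd.continuousOn hf).comp (by fun_prop) fun ζ hζ =>
    smul_mem_unitBall hζ (by rwa [Complex.norm_real, Real.norm_of_nonneg hr0])

/-- If the dilations of `f` tend to zero uniformly on a set of the sphere, so do those of all
elements of the span of the `z^k f`. -/
lemma eventually_norm_span_le {f : Cn n → ℂ} (hf : IsHol f) {r : ℕ → ℝ}
    (hr : ∀ j, 0 ≤ r j ∧ r j < 1) {F : Set (Cn n)} (hF : F ⊆ unitSphere n)
    (hu : ∀ δ > 0, ∀ᶠ j in atTop, ∀ ζ ∈ F, ‖f ((r j : ℂ) • ζ)‖ ≤ δ) {h : Cn n → ℂ}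
    (hh : h ∈ Submodule.span ℂ (range fun (k : Fin n → ℕ) (z : Cn n) => monom k z * f z)) :
    IsHol h ∧ ∀ δ > 0, ∀ᶠ j in atTop, ∀ ζ ∈ F, ‖h ((r j : ℂ) • ζ)‖ ≤ δ := by
  induction hh using Submodule.span_induction with
  | mem x hx =>
    obtain ⟨k, rfl⟩ := hx
    refine ⟨AnalyticOnNhd.mul ?_ hf, fun δ hδ => (hu δ hδ).mono fun j hj ζ hζ => ?_⟩
    · refine Finset.analyticOnNhd_fun_prod _ fun i _ => AnalyticOnNhd.pow ?_ _
      exact (EuclideanSpace.proj (𝕜 := ℂ) i : Cn n →L[ℂ] ℂ).analyticOnNhd _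
    · rw [norm_mul]
      have hz : ‖(r j : ℂ) • ζ‖ < 1 := smul_mem_unitBall (hF hζ) (by
        rw [Complex.norm_real, Real.norm_of_nonneg (hr j).1]; exact (hr j).2)
      exact (mul_le_of_le_one_left (norm_nonneg _) (norm_monom_le_one k hz.le)).trans (hj ζ hζ)
  | zero => exact ⟨analyticOnNhd_const, fun δ hδ => by simp [hδ.le]⟩
  | add x y _ _ hx hy =>
    refine ⟨AnalyticOnNhd.add hx.1 hy.1, fun δ hδ => ?_⟩
    filter_upwards [hx.2 (δ / 2) (by positivity), hy.2 (δ / 2) (by positivity)] with j h1 h2 ζ hζ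
    exact (norm_add_le _ _).trans (by linarith [h1 ζ hζ, h2 ζ hζ])
  | smul c x _ hx =>
    refine ⟨(analyticOnNhd_const.smul hx.1 : AnalyticOnNhd ℂ (fun z => c • x z) _),
      fun δ hδ => ?_⟩
    filter_upwards [hx.2 (δ / (‖c‖ + 1)) (by positivity)] with j h1 ζ hζ
    have h2 := h1 ζ hζ
    rw [le_div_iff₀ (by positivity)] at h2
    rw [Pi.smul_apply, norm_smul]
    nlinarith [norm_nonneg (x ((r j : ℂ) • ζ))]

/-- A function whose dilations tend to zero uniformly on the carrier of a nonzero measure of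
finite energy is not cyclic. -/
lemma one_notMem_closedInvariantSubspace (hn : 0 < n) {α : ℝ} (hα : 0 < α) (hαn : α ≤ n)
    {f : Cn n → ℂ} (hf : IsHol f) {μ : Measure (Cn n)} [IsFiniteMeasure μ]
    (hE : rieszEnergy α μ < ∞) {r : ℕ → ℝ} (hr : ∀ j, 0 ≤ r j ∧ r j < 1) {F : Set (Cn n)}
    (hF : F ⊆ unitSphere n) (hμF : ∀ᵐ ζ ∂μ, ζ ∈ F) (hμ0 : 0 < μ.real univ)
    (hu : ∀ δ > 0, ∀ᶠ j in atTop, ∀ ζ ∈ F, ‖f ((r j : ℂ) • ζ)‖ ≤ δ) :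
    (1 : Cn n → ℂ) ∉ closedInvariantSubspace α f := by
  rintro ⟨-, hone⟩
  have hμ : ∀ᵐ ζ ∂μ, ζ ∈ unitSphere n := hμF.mono fun ζ hζ => hF hζ
  obtain ⟨B, hB⟩ := exists_sum_momentEnergy_le hn hα hαn hμ hE
  have hB0 : 0 ≤ B := by simpa using hB 0 le_rfl one_pos 0
  set v := μ.real univ
  -- Chosen so that `ε² B < (v/2)²`; the `+ 1` covers `B = 0`.
  set ε : ℝ := v / (4 * (B + 1)) with hε
  have hε0 : 0 < ε := by positivity
  obtain ⟨h, hh, hlt⟩ := hone (ENNReal.ofReal ε) (ENNReal.ofReal_pos.2 hε0)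
  obtain ⟨hhol, hsmall⟩ := eventually_norm_span_le hf hr hF hu hh
  have huhol : IsHol (1 - h) := AnalyticOnNhd.sub analyticOnNhd_const hhol
  -- A single dilation suffices: `|h| ≤ 1/2` on `r_j F` leaves `|∫ (1 - h)(r_j ζ) dμ| ≥ v/2`.
  obtain ⟨j, hj⟩ := (hsmall (1 / 2) (by norm_num)).exists
  have hle := norm_integral_dilation_sq_le hn hα hμ hB huhol (sq_nonneg ε)
    (tsum_le_of_dirichletNorm_lt hε0.le hlt) (hr j).1 (hr j).2
  have hint : Integrable (fun ζ => h ((r j : ℂ) • ζ)) μ := by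
    have := (hhol.continuousOn_dilation (hr j).1 (hr j).2).integrableOn_compact (μ := μ)
      isCompact_unitSphere
    rwa [IntegrableOn, Measure.restrict_eq_self_of_ae_mem hμ] at this
  have e : ∫ ζ, (1 - h) ((r j : ℂ) • ζ) ∂μ = (v : ℂ) - ∫ ζ, h ((r j : ℂ) • ζ) ∂μ := by
    simp only [Pi.sub_apply, Pi.one_apply]
    rw [integral_sub (integrable_const _) hint]
    simp [v]
  have h1 := norm_integral_le_of_norm_le_const (hμF.mono fun ζ hζ => hj ζ hζ)
  have h2 : v / 2 ≤ ‖∫ ζ, (1 - h) ((r j : ℂ) • ζ) ∂μ‖ := by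
    rw [e]
    have := norm_sub_norm_le (v : ℂ) (∫ ζ, h ((r j : ℂ) • ζ) ∂μ)
    rw [Complex.norm_real, Real.norm_of_nonneg hμ0.le] at this
    linarith
  have h3 := (pow_le_pow_left₀ (by positivity) h2 2).trans hle
  have h4 : ε ^ 2 * B < (v / 2) ^ 2 := by
    have h5 : ε * (4 * (B + 1)) = v := div_mul_cancel₀ _ (by positivity)
    rw [← h5]
    have := sq_pos_of_pos hε0
    nlinarith [mul_nonneg this.le hB0, mul_nonneg this.le (sq_nonneg B)]
  linarith

/-- Egorov's theorem for radial limits: uniform convergence on a set of positive measure. -/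
lemma exists_uniform_radial_limit {f : Cn n → ℂ} (hf : IsHol f) {μ : Measure (Cn n)}
    [IsProbabilityMeasure μ] (hμ : μ (radialZeroSet f)ᶜ = 0) {r : ℕ → ℝ}
    (hr : ∀ j, 0 ≤ r j ∧ r j < 1) (hr1 : Tendsto r atTop (𝓝 1)) :
    ∃ F ⊆ unitSphere n, MeasurableSet F ∧ 0 < μ F ∧
      ∀ δ > 0, ∀ᶠ j in atTop, ∀ ζ ∈ F, ‖f ((r j : ℂ) • ζ)‖ ≤ δ := by
  classical
  have hS : MeasurableSet (unitSphere n) := isCompact_unitSphere.isClosed.measurableSet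
  have hZ : ∀ᵐ ζ ∂μ, ζ ∈ radialZeroSet f := hμ
  -- Off the sphere `r_j ζ` may leave the ball, where `f` is arbitrary; the indicator makes `G j`
  -- measurable everywhere.
  set G : ℕ → Cn n → ℂ := fun j => (unitSphere n).indicator fun ζ => f ((r j : ℂ) • ζ)
  have hG : ∀ j, StronglyMeasurable (G j) := fun j => by
    simp only [G, ← piecewise_eq_indicator]
    exact ((hf.continuousOn_dilation (hr j).1 (hr j).2).measurable_piecewise
      continuousOn_const hS).stronglyMeasurable
  have hGe : ∀ j, ∀ ζ ∈ unitSphere n, G j ζ = f ((r j : ℂ) • ζ) := fun j ζ hζ =>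
    indicator_of_mem hζ _
  have hr' : Tendsto r atTop (𝓝[<] 1) :=
    tendsto_nhdsWithin_iff.2 ⟨hr1, Eventually.of_forall fun j => (hr j).2⟩
  have hlim : ∀ᵐ ζ ∂μ, Tendsto (fun j => G j ζ) atTop (𝓝 ((0 : Cn n → ℂ) ζ)) :=
    hZ.mono fun ζ hζ => by
      simp only [hGe _ ζ hζ.1]
      exact hζ.2.comp hr'
  obtain ⟨t, ht, hμt, hunif⟩ := tendstoUniformlyOn_of_ae_tendsto' hG stronglyMeasurable_zero hlim
    (ε := 1 / 2) (by norm_num)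
  -- `F` need not lie in the zero set, whose measurability is never used; only uniform decay on `F`
  -- matters.
  refine ⟨unitSphere n \ t, sdiff_subset, hS.diff ht, ?_, fun δ hδ => ?_⟩
  · have h1 : μ (unitSphere n) = 1 := (prob_compl_eq_zero_iff hS).1
      (measure_mono_null (compl_subset_compl.2 fun ζ hζ => hζ.1) hμ)
    have h2 : μ t < μ (unitSphere n) := by
      rw [h1]
      refine hμt.trans_lt ?_
      rw [ENNReal.ofReal_lt_one]
      norm_num
    exact (tsub_pos_of_lt h2).trans_le le_measure_sdiff
  · filter_upwards [Metric.tendstoUniformlyOn_iff.1 hunif δ hδ] with j hj ζ hζ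
    have := (hj ζ hζ.2).le
    rwa [hGe j ζ hζ.1, Pi.zero_apply, dist_zero_left] at this

/-- The kernel takes values in `[0, ∞]`, so cutting `μ` down to the Egorov set keeps the energy
finite. -/
lemma rieszEnergy_mono (α : ℝ) {μ ν : Measure (Cn n)} (h : μ ≤ ν) :
    rieszEnergy α μ ≤ rieszEnergy α ν :=
  lintegral_mono' h fun _ => lintegral_mono' h le_rfl

lemma exists_energy_lt_top {α : ℝ} {E : Set (Cn n)} (h : 0 < rieszCapacity α E) :
    ∃ μ : Measure (Cn n), IsProbabilityMeasure μ ∧ μ Eᶜ = 0 ∧ rieszEnergy α μ < ∞ := by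
  rw [rieszCapacity, ENNReal.inv_pos, ← lt_top_iff_ne_top] at h
  obtain ⟨μ, hμ⟩ := iInf_lt_iff.1 h
  obtain ⟨hμ', hE⟩ := iInf_lt_iff.1 hμ
  exact ⟨μ, hμ'.1, hμ'.2, hE⟩

end DirichletBall

end

theorem mainTheorem3 (n : ℕ) (α : ℝ) (hα : 0 < α) (hαn : α ≤ n)
    (f : DirichletBall.Cn n → ℂ) (hf : f ∈ DirichletBall.dirichletSpace n α)
    (hcap : 0 < DirichletBall.rieszCapacity α (DirichletBall.radialZeroSet f)) :
    ¬ DirichletBall.IsCyclic α f := by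
  have hn : 0 < n := by exact_mod_cast hα.trans_le hαn
  obtain ⟨μ, hμ, hμZ, hE⟩ := DirichletBall.exists_energy_lt_top hcap
  set r : ℕ → ℝ := fun j => 1 - 1 / ((j : ℝ) + 1)
  have hr : ∀ j, 0 ≤ r j ∧ r j < 1 := fun j => by
    have h1 : (0 : ℝ) < 1 / ((j : ℝ) + 1) := Nat.one_div_pos_of_nat
    have h2 : 1 / ((j : ℝ) + 1) ≤ 1 := by
      rw [div_le_one (by positivity)]; linarith [j.cast_nonneg (α := ℝ)]
    simp only [r]
    constructor <;> linarith
  have hr1 : Tendsto r atTop (𝓝 1) := by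
    simpa [r] using (tendsto_one_div_add_atTop_nhds_zero_nat (𝕜 := ℝ)).const_sub 1
  obtain ⟨F, hFS, hFm, hF0, hu⟩ :=
    DirichletBall.exists_uniform_radial_limit hf.1 hμZ hr hr1
  rintro ⟨-, hcyc⟩
  refine DirichletBall.one_notMem_closedInvariantSubspace (μ := μ.restrict F) hn hα hαn hf.1
    ((DirichletBall.rieszEnergy_mono α Measure.restrict_le_self).trans_lt hE) hr hFS
    (ae_restrict_mem hFm) ?_ hu (hcyc ▸ DirichletBall.one_mem_dirichletSpace n α)
  rw [measureReal_def, Measure.restrict_apply_univ]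
  exact ENNReal.toReal_pos hF0.ne' (measure_ne_top _ _)
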